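/- Let $\mathfrak g$ be a finite-dimensional semisimple Lie algebra over a field $k$ of characteristic $0$ with Killing form $\kappa$, let $R$ be a commutative $k$-algebra, and let $B$ be a Lie algebra over $R$ that is a twisted form of $\mathfrak g\otimes_k R$ split by a faithfully flat commutative $R$-algebra $S$, i.e. $B\otimes_R S\cong \mathfrak g\otimes_k S$ as Lie algebras over $S$. (a) $B$ is a finitely generated projective $R$-module and is perfect, i.e. spanned by its products. Hence the Killing form $\kappa_B(x,y)=\operatorname{tr}(\operatorname{ad}x\circ\operatorname{ad}y)$ of $B$ is defined, using the trace of endomorphisms of finitely generated projective modules. It is the unique $R$-bilinear form on $B$ with the following property: for every faithfully flat commutative $R$-algebra $T$ and every isomorphism $\theta\colon B\otimes_R T\to\mathfrak g\otimes_k T$ of Lie algebras over $T$, the base change $(\kappa_B)_T$ is the pullback $\theta^*(\kappa_T)$ of the base change of $\kappa$. Moreover, $\kappa_B$ is nonsingular, i.e. $x\mapsto\kappa_B(x,-)$ is a bijection $B\to\operatorname{Hom}_R(B,R)$, and it is $\mathbf{Aut}(B)$-invariant, i.e. for every commutative $R$-algebra $T$ its base change $(\kappa_B)_T$ is invariant under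 all automorphisms of the Lie algebra $B\otimes_R T$ over $T$. If $T$ is a faithfully flat commutative $R$-algebra and $B$ is realized as an $R$-subalgebra of $\mathfrak g\otimes_k T$ by means of an isomorphism $B\otimes_R T\cong\mathfrak g\otimes_k T$ of Lie algebras over $T$ (that is, identified with the image of $B\otimes 1$), then $\kappa_B$ is the restriction to $B$ of the Killing form of $\mathfrak g\otimes_k T$. (b) Assume moreover that $\mathfrak g$ is central, i.e. that the natural map from $k$ to the centroid of $\mathfrak g$ is bijective, where the centroid of a Lie algebra $L$ over a commutative ring $K$ consists of all $K$-linear maps $\chi\colon L\to L$ with $\chi([a,b])=[a,\chi(b)]=[\chi(a),b]$ for all $a,b\in L$. Then $\mathfrak g$ is simple and $B$ is a central $R$-algebra. For a $k$-module $V$, call a $k$-bilinear map $\gamma\colon B\times B\to V$ invariant if $\gamma([a,b],c)=\gamma(a,[b,c])=\gamma(b,[c,a])$ for all $a,b,c\in B$. The $R$-module $\mathrm{IBF}_R(B)$ of invariant $R$-bilinear forms $B\times B\to R$ is free of rank $1$ with basis $\kappa_B$, and $(B,\kappa_B)$ satisfies the IBF-principle. This means the following. Let $\mathbf{IBF}_R(B)$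 be the quotient of $B\otimes_R B$ by the submodule spanned by all $[a,b]\otimes c-a\otimes[b,c]$ and $[a,b]\otimes c-b\otimes[c,a]$ with $a,b,c\in B$. Then the map $\mathbf{IBF}_R(B)\to R$, $\overline{x\otimes y}\mapsto\kappa_B(x,y)$, is an isomorphism of $R$-modules. Furthermore, for every $k$-module $V$ the map $\varphi\mapsto\varphi\circ\kappa_B$ is an isomorphism of $R$-modules from $\operatorname{Hom}_k(R,V)$ to the module $\mathrm{IBF}_{(R,k)}(B;V)$ of invariant $k$-bilinear maps $\gamma\colon B\times B\to V$ with $\gamma(rx,y)=\gamma(x,ry)$ for all $r\in R$, where $(r\varphi)(s)=\varphi(rs)$ and $(r\gamma)(x,y)=\gamma(rx,y)$. In fact every invariant $k$-bilinear map $\gamma\colon B\times B\to V$ is of the form $\varphi\circ\kappa_B$ for a unique $\varphi\in\operatorname{Hom}_k(R,V)$; in particular every invariant $k$-bilinear form on $B$ is $\varphi\circ\kappa_B$ for a unique $\varphi\in R^*=\operatorname{Hom}_k(R,k)$. -/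

import Mathlib

open scoped TensorProduct

noncomputable section

/-! ### Trace and Killing form over finitely generated projective modules -/

open Classical in
/-- The trace of an endomorphism of a finitely generated projective `R`-module `M`: the inverse of
the canonical isomorphism `Mᵛ ⊗ M → End M`, followed by the evaluation map `Mᵛ ⊗ M → R`.
(`LinearMap.trace` is only meaningful on free modules; on other modules it is zero.) -/
def projTrace (R M : Type*) [CommRing R] [AddCommGroup M] [Module R M] :
    (M →ₗ[R] M) →ₗ[R] R :=
  if h : Function.Bijective (dualTensorHom R M M) then
    contractLeft R M ∘ₗ (LinearEquiv.ofBijective (dualTensorHom R M M) h).symm.toLinearMap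
  else 0

/-- On finitely generated projective modules `projTrace` is determined by its value `f m` on the
rank one endomorphism `x ↦ f x • m`. -/
theorem projTrace_dualTensorHom (R M : Type*) [CommRing R] [AddCommGroup M] [Module R M]
    [Module.Finite R M] [Module.Projective R M] (t : Module.Dual R M ⊗[R] M) :
    projTrace R M (dualTensorHom R M M t) = contractLeft R M t := by
  have h : Function.Bijective (dualTensorHom R M M) := dualTensorHom_bijective
  rw [projTrace, dif_pos h, LinearMap.comp_apply]
  congr 1
  exact (LinearEquiv.ofBijective (dualTensorHom R M M) h).symm_apply_apply t

/-- On finite free modules `projTrace` is the usual trace. -/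
theorem projTrace_eq_trace (R M : Type*) [CommRing R] [AddCommGroup M] [Module R M]
    [Module.Finite R M] [Module.Free R M] : projTrace R M = LinearMap.trace R M := by
  ext f
  obtain ⟨t, rfl⟩ := (dualTensorHom_bijective (R := R) (M := M) (N := M)).2 f
  rw [projTrace_dualTensorHom, LinearMap.trace_eq_contract_apply]

section KillingForm

attribute [local instance 100] LieRing.ofAssociativeRing

/-- The Killing form `(x, y) ↦ tr (ad x ∘ ad y)` of a Lie algebra `L` over `R` whose underlying
module is finitely generated and projective. -/
def projKillingForm (R L : Type*) [CommRing R] [LieRing L] [LieAlgebra R L] :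
    LinearMap.BilinForm R L :=
  ((LinearMap.mul R (Module.End R L)).compl₁₂
    (LieAlgebra.ad R L).toLinearMap (LieAlgebra.ad R L).toLinearMap).compr₂ (projTrace R L)

theorem projKillingForm_apply (R L : Type*) [CommRing R] [LieRing L] [LieAlgebra R L] (x y : L) :
    projKillingForm R L x y = projTrace R L (LieAlgebra.ad R L x ∘ₗ LieAlgebra.ad R L y) :=
  rfl

theorem projKillingForm_eq_killingForm (R L : Type*) [CommRing R] [LieRing L] [LieAlgebra R L]
    [Module.Finite R L] [Module.Free R L] : projKillingForm R L = killingForm R L := by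
  ext x y
  rw [projKillingForm_apply, projTrace_eq_trace, killingForm_apply_apply]

end KillingForm

/-! ### Perfect and central Lie algebras -/

/-- `L` is perfect: it is spanned by the products of its elements. -/
def IsPerfectLie (R L : Type*) [CommRing R] [LieRing L] [LieAlgebra R L] : Prop :=
  Submodule.span R {x : L | ∃ a b : L, x = ⁅a, b⁆} = ⊤

/-- The centroid of `L`: the `R`-linear maps `χ : L → L` with `χ [a,b] = [a, χ b] = [χ a, b]`. -/
def lieCentroid (R L : Type*) [CommRing R] [LieRing L] [LieAlgebra R L] :
    Submodule R (L →ₗ[R] L) where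
  carrier := {χ | ∀ a b : L, χ ⁅a, b⁆ = ⁅a, χ b⁆ ∧ χ ⁅a, b⁆ = ⁅χ a, b⁆}
  add_mem' := by
    intro χ ψ hχ hψ a b
    have h₁ := hχ a b
    have h₂ := hψ a b
    constructor
    · rw [LinearMap.add_apply, LinearMap.add_apply, h₁.1, h₂.1, lie_add]
    · rw [LinearMap.add_apply, LinearMap.add_apply, h₁.2, h₂.2, add_lie]
  zero_mem' := by intro a b; simp
  smul_mem' := by
    intro r χ hχ a b
    have h := hχ a b
    constructor
    · rw [LinearMap.smul_apply, LinearMap.smul_apply, h.1, lie_smul]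
    · rw [LinearMap.smul_apply, LinearMap.smul_apply, h.2, smul_lie]

/-- The natural map `R → Cent_R(L)`, `r ↦ (x ↦ r x)`. -/
def toLieCentroid (R L : Type*) [CommRing R] [LieRing L] [LieAlgebra R L] :
    R →ₗ[R] lieCentroid R L :=
  LinearMap.toSpanSingleton R (lieCentroid R L) ⟨LinearMap.id, fun _ _ => ⟨rfl, rfl⟩⟩

/-- `L` is a central `R`-algebra: the natural map from `R` to the centroid is an isomorphism. -/
def IsCentralLie (R L : Type*) [CommRing R] [LieRing L] [LieAlgebra R L] : Prop :=
  Function.Bijective (toLieCentroid R L)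

/-! ### Bilinear forms -/

/-- `β : M × M → R` is nonsingular: `m ↦ β(m, -)` is a bijection from `M` to its dual. -/
def IsNonsingular {R M : Type*} [CommRing R] [AddCommGroup M] [Module R M]
    (β : LinearMap.BilinForm R M) : Prop :=
  Function.Bijective (fun m : M => (β m : Module.Dual R M))

/-- `β` is invariant under the automorphism group functor `T ↦ Aut_T (T ⊗ L)` of `L`, where `T`
runs over all commutative `R`-algebras. -/
def IsAutInvariant.{w, u, v} {R : Type u} {L : Type v} [CommRing R] [LieRing L] [LieAlgebra R L]
    (β : LinearMap.BilinForm R L) : Prop :=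
  ∀ (T : Type w) [CommRing T] [Algebra R T] (f : (T ⊗[R] L) ≃ₗ⁅T⁆ (T ⊗[R] L)) (x y : T ⊗[R] L),
    LinearMap.BilinForm.baseChange T β (f x) (f y) = LinearMap.BilinForm.baseChange T β x y

/-- A `k`-bilinear map `β : L × L → V` is invariant if `β(ab, c) = β(a, bc) = β(b, ca)`. -/
def IsInvariantBilin {k L V : Type*} [CommRing k] [LieRing L] [Module k L]
    [AddCommGroup V] [Module k V] (β : L →ₗ[k] L →ₗ[k] V) : Prop :=
  ∀ a b c : L, β ⁅a, b⁆ c = β a ⁅b, c⁆ ∧ β a ⁅b, c⁆ = β b ⁅c, a⁆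

/-- The `R`-module `IBF_R(L)` of invariant `R`-bilinear forms on `L`. -/
def invariantForms (R L : Type*) [CommRing R] [LieRing L] [LieAlgebra R L] :
    Submodule R (LinearMap.BilinForm R L) where
  carrier := {β | IsInvariantBilin β}
  add_mem' := by
    intro β γ hβ hγ a b c
    simp only [LinearMap.add_apply]
    exact ⟨by rw [(hβ a b c).1, (hγ a b c).1], by rw [(hβ a b c).2, (hγ a b c).2]⟩
  zero_mem' := by intro a b c; simp
  smul_mem' := by
    intro r β hβ a b c
    simp only [LinearMap.smul_apply]
    exact ⟨by rw [(hβ a b c).1], by rw [(hβ a b c).2]⟩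

/-- The module `IBF_{(R,k)}(L; V)` of invariant `k`-bilinear maps `β : L × L → V` that satisfy
`β(r x, y) = β(x, r y)` for all `r ∈ R`. -/
def invariantMaps (k R L V : Type*) [CommRing k] [CommRing R]
    [LieRing L] [LieAlgebra R L] [Module k L] [AddCommGroup V] [Module k V] :
    Submodule k (L →ₗ[k] L →ₗ[k] V) where
  carrier := {β | IsInvariantBilin β ∧ ∀ (r : R) (x y : L), β (r • x) y = β x (r • y)}
  add_mem' := by
    rintro β γ ⟨hβ, hβ'⟩ ⟨hγ, hγ'⟩
    refine ⟨fun a b c => ?_, fun r x y => ?_⟩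
    · simp only [LinearMap.add_apply]
      exact ⟨by rw [(hβ a b c).1, (hγ a b c).1], by rw [(hβ a b c).2, (hγ a b c).2]⟩
    · simp only [LinearMap.add_apply]
      rw [hβ', hγ']
  zero_mem' := ⟨fun a b c => by simp, fun r x y => by simp⟩
  smul_mem' := by
    rintro t β ⟨hβ, hβ'⟩
    refine ⟨fun a b c => ?_, fun r x y => ?_⟩
    · simp only [LinearMap.smul_apply]
      exact ⟨by rw [(hβ a b c).1], by rw [(hβ a b c).2]⟩
    · simp only [LinearMap.smul_apply]
      rw [hβ']

/-- `IBF_{(R,k)}(L; V)` is an `R`-module for `(r β)(x, y) = β(r x, y)`. -/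
def invariantMapsSMul {k R L V : Type*} [CommRing k] [CommRing R] [Algebra k R]
    [LieRing L] [LieAlgebra R L] [Module k L] [IsScalarTower k R L] [AddCommGroup V] [Module k V]
    (r : R) (β : invariantMaps k R L V) : invariantMaps k R L V :=
  ⟨(β : L →ₗ[k] L →ₗ[k] V) ∘ₗ Algebra.lsmul k k L r, by
    obtain ⟨β, hβ, hβ'⟩ := β
    refine ⟨fun a b c => ?_, fun s x y => ?_⟩
    · simp only [LinearMap.comp_apply, Algebra.lsmul_coe]
      constructor
      · rw [← smul_lie, (hβ _ _ _).1]
      · rw [(hβ _ _ _).2, lie_smul, hβ', ← lie_smul]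
    · simp only [LinearMap.comp_apply, Algebra.lsmul_coe]
      rw [smul_comm, hβ']⟩

/-! ### The universal invariant bilinear map and the IBF-principle -/

/-- The submodule `ibf_R(L)` of `L ⊗_R L` spanned by all `ab ⊗ c - a ⊗ bc` and `ab ⊗ c - b ⊗ ca`. -/
def ibfRelations (R L : Type*) [CommRing R] [LieRing L] [LieAlgebra R L] :
    Submodule R (L ⊗[R] L) :=
  Submodule.span R {t | ∃ a b c : L,
    t = ⁅a, b⁆ ⊗ₜ[R] c - a ⊗ₜ[R] ⁅b, c⁆ ∨ t = ⁅a, b⁆ ⊗ₜ[R] c - b ⊗ₜ[R] ⁅c, a⁆}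

/-- The target `𝐈𝐁𝐅_R(L) = (L ⊗_R L) / ibf_R(L)` of the universal invariant bilinear map
`(a, b) ↦ class of a ⊗ b`. -/
abbrev UniversalIBF (R L : Type*) [CommRing R] [LieRing L] [LieAlgebra R L] : Type _ :=
  (L ⊗[R] L) ⧸ ibfRelations R L

/-- The `R`-linear map `𝐈𝐁𝐅_R(L) → R`, `class of a ⊗ b ↦ β(a, b)`, induced by an invariant
`R`-bilinear form `β`. -/
def inducedMap {R L : Type*} [CommRing R] [LieRing L] [LieAlgebra R L]
    (β : invariantForms R L) : UniversalIBF R L →ₗ[R] R :=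
  (ibfRelations R L).liftQ (TensorProduct.lift (β : LinearMap.BilinForm R L)) <| by
    rw [ibfRelations, Submodule.span_le]
    rintro t ⟨a, b, c, rfl | rfl⟩
    · simp [(β.2 a b c).1]
    · simp [(β.2 a b c).1, (β.2 a b c).2]

/-- The map `Hom_k(R, V) → IBF_{(R,k)}(L; V)`, `φ ↦ φ ∘ β`, for an invariant `R`-bilinear
form `β`. -/
def compForm (k : Type*) {R L : Type*} (V : Type*) [CommRing k] [CommRing R] [Algebra k R]
    [LieRing L] [LieAlgebra R L] [Module k L] [IsScalarTower k R L]
    [AddCommGroup V] [Module k V] (β : invariantForms R L) :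
    (R →ₗ[k] V) →ₗ[k] invariantMaps k R L V where
  toFun φ := ⟨LinearMap.mk₂ k (fun x y => φ ((β : LinearMap.BilinForm R L) x y))
      (by intro x x' y; simp)
      (by intro c x y
          rw [← algebraMap_smul R c x, map_smul, LinearMap.smul_apply, algebraMap_smul, map_smul])
      (by intro x y y'; simp)
      (by intro c x y
          rw [← algebraMap_smul R c y, map_smul, algebraMap_smul, map_smul]), by
    refine ⟨fun a b c => ⟨?_, ?_⟩, fun r x y => ?_⟩
    · simp only [LinearMap.mk₂_apply]; rw [(β.2 a b c).1]
    · simp only [LinearMap.mk₂_apply]; rw [(β.2 a b c).2]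
    · simp⟩
  map_add' φ ψ := by ext; rfl
  map_smul' r φ := by ext; rfl

theorem compForm_apply (k : Type*) {R L : Type*} (V : Type*) [CommRing k] [CommRing R]
    [Algebra k R] [LieRing L] [LieAlgebra R L] [Module k L] [IsScalarTower k R L]
    [AddCommGroup V] [Module k V] (β : invariantForms R L) (φ : R →ₗ[k] V) (x y : L) :
    (compForm k V β φ : L →ₗ[k] L →ₗ[k] V) x y = φ ((β : LinearMap.BilinForm R L) x y) :=
  rfl

/-- The IBF-principle for `(L, β)`: the form `β` is an invariant `R`-bilinear form, the induced map
`𝐈𝐁𝐅_R(L) → R` is an isomorphism, and, for every `k`-module `V`, the map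
`Hom_k(R, V) → IBF_{(R,k)}(L; V)`, `φ ↦ φ ∘ β`, is bijective and `R`-linear, where the `R`-module
structures are `(r φ)(s) = φ(r s)` and `(r γ)(x, y) = γ(r x, y)`. -/
def SatisfiesIBFPrinciple.{v, a, b, c} (k : Type a) {R : Type b} {L : Type c}
    [CommRing k] [CommRing R] [Algebra k R]
    [LieRing L] [LieAlgebra R L] [Module k L] [IsScalarTower k R L]
    (β : LinearMap.BilinForm R L) : Prop :=
  ∃ hβ : β ∈ invariantForms R L,
    Function.Bijective (inducedMap ⟨β, hβ⟩) ∧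
    ∀ (V : Type v) [AddCommGroup V] [Module k V],
      Function.Bijective (compForm k V ⟨β, hβ⟩) ∧
      ∀ (r : R) (φ : R →ₗ[k] V),
        compForm k V ⟨β, hβ⟩ (φ ∘ₗ LinearMap.mulLeft k r) =
          invariantMapsSMul r (compForm k V ⟨β, hβ⟩ φ)

/-! ### Twisted forms -/

section Descent

/-- `B` is a twisted form of `𝔤 ⊗_k R` split by `S`: the `S`-algebras `B ⊗_R S` and
`(𝔤 ⊗_k R) ⊗_R S = 𝔤 ⊗_k S` are isomorphic. (Scalars are written on the left.) -/
def IsSplitBy (k R S 𝔤 B : Type*) [CommRing k] [CommRing R] [CommRing S]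
    [Algebra k S] [Algebra R S]
    [LieRing 𝔤] [LieAlgebra k 𝔤] [LieRing B] [LieAlgebra R B] : Prop :=
  Nonempty ((S ⊗[R] B) ≃ₗ⁅S⁆ (S ⊗[k] 𝔤))

/-- The `R`-bilinear form `β` on the twisted form `B` of `𝔤 ⊗_k R` is associated to the
`k`-bilinear form `κ` on `𝔤`: after every faithfully flat extension `T/R` and for every isomorphism
`θ : B ⊗_R T ≃ 𝔤 ⊗_k T` of `T`-algebras, the base change of `β` is the pullback under `θ` of the
base change of `κ`. -/
def IsAssociatedForm.{w, a, b, c, d} {k : Type a} {R : Type b} {𝔤 : Type c} {B : Type d}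
    [CommRing k] [CommRing R] [Algebra k R]
    [LieRing 𝔤] [LieAlgebra k 𝔤] [LieRing B] [LieAlgebra R B]
    (κ : LinearMap.BilinForm k 𝔤) (β : LinearMap.BilinForm R B) : Prop :=
  ∀ (T : Type w) [CommRing T] [Algebra k T] [Algebra R T] [IsScalarTower k R T]
    [Module.FaithfullyFlat R T] (θ : (T ⊗[R] B) ≃ₗ⁅T⁆ (T ⊗[k] 𝔤)) (x y : T ⊗[R] B),
    LinearMap.BilinForm.baseChange T β x y = LinearMap.BilinForm.baseChange T κ (θ x) (θ y)

/-- The map `ι` realizes `B` as an `R`-subalgebra of `𝔤 ⊗_k T`: it is a homomorphism of `R`-algebras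
whose `T`-linear extension `B ⊗_R T → 𝔤 ⊗_k T` is an isomorphism. Equivalently, `ι b = θ (b ⊗ 1)`
for an isomorphism `θ` of `T`-algebras from `B ⊗_R T` to `𝔤 ⊗_k T`. If `T/R` is faithfully flat,
then `ι` is injective and its image is the subalgebra cut out by the descent cocycle of `θ`. -/
structure IsRealization {k R T 𝔤 B : Type*} [CommRing k] [CommRing R] [CommRing T]
    [Algebra k R] [Algebra k T] [Algebra R T] [IsScalarTower k R T]
    [LieRing 𝔤] [LieAlgebra k 𝔤] [LieRing B] [LieAlgebra R B]
    (ι : B →ₗ[R] T ⊗[k] 𝔤) : Prop where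
  map_lie : ∀ x y : B, ι ⁅x, y⁆ = ⁅ι x, ι y⁆
  isBaseChange : IsBaseChange T ι

end Descent

end

universe uS uT uV

/-! Faithfully flat descent reduces everything to `S ⊗ 𝔤`. Traces on finitely generated projective
modules commute with base change and are invariant under conjugation, so the Killing form of `B`
becomes that of `S ⊗ 𝔤` along any splitting (`projKillingForm_baseChange_of_equiv`). Since `R → S`
is injective, identities such as symmetry, invariance and uniqueness can be tested over `S`.
Perfectness and nonsingularity say that certain maps are surjective or bijective, which faithful
flatness reflects.

For central `𝔤`, nondegeneracy of `κ` turns an invariant form on `𝔤` into `κ(χ x, y)` with `χ` in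
the centroid, hence into a multiple of `κ`; the same then holds for values in any vector space.
Applied to the universal invariant map of `B` after base change to `S`, this shows that `1 ⊗ [t]` is
`κ_B(t)` times a fixed element, so `κ_B(t) = 0` forces `[t] = 0`. As `κ` takes the value `1` on `𝔤`,
the ideal generated by the values of `κ_B` is all of `R`. Hence the universal target is `R`
(`IsCentralLie.bijective_inducedMap`).

The remaining claims are formal: perfectness makes every invariant `k`-bilinear map `R`-balanced, so
it factors through the universal target (`existsUnique_comp_form`). Freeness and centrality follow.
-/

noncomputable section

/-! ### Descent of finitely generated projective modules -/

section Descent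

variable {R : Type*} (S : Type*) [CommRing R] [CommRing S] [Algebra R S] [Module.FaithfullyFlat R S]
  (M : Type*) [AddCommGroup M] [Module R M]

/-- Finite presentation descends along faithfully flat ring maps. -/
theorem Module.FinitePresentation.of_faithfullyFlat_baseChange
    [Module.FinitePresentation S (S ⊗[R] M)] : Module.FinitePresentation R M := by
  have : Module.Finite R M := Module.Finite.of_finite_tensorProduct_of_faithfullyFlat S
  obtain ⟨n, f, hf⟩ := Module.Finite.exists_fin' R M
  have hfS : Function.Surjective (TensorProduct.AlgebraTensorModule.lTensor S S f) :=
    LinearMap.lTensor_surjective S hf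
  -- The kernel over `S` is finitely generated, and by flatness it is `S ⊗ ker f`, so finite
  -- generation of `ker f` descends.
  have hker := Module.FinitePresentation.fg_ker _ hfS
  have : Module.Finite S (TensorProduct.AlgebraTensorModule.lTensor S S f).ker :=
    Module.Finite.iff_fg.mpr hker
  have : Module.Finite S (S ⊗[R] f.ker) :=
    Module.Finite.equiv (LinearMap.tensorKerEquiv S S f).symm
  have : Module.Finite R f.ker := Module.Finite.of_finite_tensorProduct_of_faithfullyFlat S
  exact Module.finitePresentation_of_surjective f hf (Module.Finite.iff_fg.mp this)

/-- Projectivity of finitely presented modules descends along faithfully flat ring maps. -/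
theorem Module.Projective.of_faithfullyFlat_baseChange
    [Module.Finite S (S ⊗[R] M)] [Module.Projective S (S ⊗[R] M)] : Module.Projective R M := by
  have : Module.FinitePresentation S (S ⊗[R] M) := Module.finitePresentation_of_projective _ _
  have : Module.FinitePresentation R M := .of_faithfullyFlat_baseChange S M
  have : Module.Flat R M := Module.Flat.of_flat_tensorProduct R M S
  exact Module.Flat.projective_of_finitePresentation

end Descent

/-! ### Properties of the trace on finitely generated projective modules -/

section Trace

variable {R M : Type*} [CommRing R] [AddCommGroup M] [Module R M]
  [Module.Finite R M] [Module.Projective R M]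

/-- Endomorphisms are sums of rank one maps, and the base change of a rank one map is the rank one
map of the base-changed data. -/
theorem projTrace_baseChange (T : Type*) [CommRing T] [Algebra R T] (f : M →ₗ[R] M) :
    projTrace T (T ⊗[R] M) (f.baseChange T) = algebraMap R T (projTrace R M f) := by
  obtain ⟨t, rfl⟩ := (dualTensorHom_bijective (R := R) (M := M) (N := M)).2 f
  induction t with
  | zero => simp
  | add t u ht hu => simp only [map_add, LinearMap.baseChange_add, ht, hu]
  | tmul f m =>
    have h : (dualTensorHom R M M (f ⊗ₜ m)).baseChange T =
        dualTensorHom T (T ⊗[R] M) (T ⊗[R] M) (Module.Dual.baseChange T f ⊗ₜ (1 ⊗ₜ m)) := by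
      ext x
      simp [TensorProduct.smul_tmul']
    rw [h, projTrace_dualTensorHom, projTrace_dualTensorHom]
    simp [Algebra.algebraMap_eq_smul_one]

theorem projTrace_conj {M' : Type*} [AddCommGroup M'] [Module R M']
    [Module.Finite R M'] [Module.Projective R M'] (e : M ≃ₗ[R] M') (f : M →ₗ[R] M) :
    projTrace R M' (e.toLinearMap ∘ₗ f ∘ₗ e.symm.toLinearMap) = projTrace R M f := by
  obtain ⟨t, rfl⟩ := (dualTensorHom_bijective (R := R) (M := M) (N := M)).2 f
  induction t with
  | zero => simp
  | add t u ht hu => simp only [map_add, LinearMap.comp_add, LinearMap.add_comp, ht, hu]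
  | tmul f m =>
    have h : e.toLinearMap ∘ₗ dualTensorHom R M M (f ⊗ₜ m) ∘ₗ e.symm.toLinearMap =
        dualTensorHom R M' M' ((f ∘ₗ e.symm.toLinearMap) ⊗ₜ e m) := by
      ext x
      simp
    rw [h, projTrace_dualTensorHom, projTrace_dualTensorHom]
    simp

end Trace

/-! ### Properties of the Killing form -/

section KillingForm

attribute [local instance 100] LieRing.ofAssociativeRing

variable {R L : Type*} [CommRing R] [LieRing L] [LieAlgebra R L]
  [Module.Finite R L] [Module.Projective R L]

theorem projKillingForm_baseChange (T : Type*) [CommRing T] [Algebra R T] :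
    projKillingForm T (T ⊗[R] L) = (projKillingForm R L).baseChange T := by
  ext x y
  have had : ∀ z : L, LieAlgebra.ad T (T ⊗[R] L) (1 ⊗ₜ z) = (LieAlgebra.ad R L z).baseChange T :=
    fun z => LieModule.toEnd_baseChange R T L L z
  simp [projKillingForm_apply, had, ← LinearMap.baseChange_comp, projTrace_baseChange,
    Algebra.algebraMap_eq_smul_one]

theorem projKillingForm_of_equiv {L' : Type*} [LieRing L'] [LieAlgebra R L']
    [Module.Finite R L'] [Module.Projective R L'] (e : L ≃ₗ⁅R⁆ L') (x y : L) :
    projKillingForm R L' (e x) (e y) = projKillingForm R L x y := by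
  rw [projKillingForm_apply, projKillingForm_apply, ← projTrace_conj e.toLinearEquiv]
  congr 1
  ext z
  have hz : e (e.toLinearEquiv.symm z) = z := e.toLinearEquiv.apply_symm_apply z
  simp only [LinearMap.comp_apply, LieAlgebra.ad_apply, LinearEquiv.coe_coe,
    LieEquiv.coe_toLinearEquiv, LieEquiv.map_lie, hz]

end KillingForm

/-! ### Invariant bilinear maps -/

section Invariant

variable {k L : Type*} [CommRing k] [LieRing L] [LieAlgebra k L]

theorem isInvariantBilin_killingForm : IsInvariantBilin (killingForm k L) := by
  intro a b c
  have h := LieModule.traceForm_apply_lie_apply k L L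
  refine ⟨h a b c, ?_⟩
  rw [← h a b c, ← LieModule.traceForm_comm k L L c, ← h c a b,
    LieModule.traceForm_comm k L L b]

theorem IsInvariantBilin.baseChange {U : Type*} [AddCommGroup U] [Module k U]
    {β : LinearMap.BilinMap k L U} (hβ : IsInvariantBilin β)
    (T : Type*) [CommRing T] [Algebra k T] : IsInvariantBilin (β.baseChange T) := by
  intro a b c
  induction a with
  | zero => simp
  | add a a' h h' =>
    simp only [add_lie, lie_add, map_add, LinearMap.add_apply, h.1, h.2, h'.1, h'.2, and_self]
  | tmul r a =>
    induction b with
    | zero => simp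
    | add b b' h h' =>
      simp only [add_lie, lie_add, map_add, LinearMap.add_apply, h.1, h.2, h'.1, h'.2, and_self]
    | tmul s b =>
      induction c with
      | zero => simp
      | add c c' h h' => simp only [add_lie, lie_add, map_add, h.1, h.2, h'.1, h'.2, and_self]
      | tmul t c =>
        simp only [LieAlgebra.ExtendScalars.bracket_tmul, LinearMap.BilinMap.baseChange_tmul,
          (hβ a b c).1, (hβ a b c).2]
        constructor <;> congr 1 <;> ring

/-- If `χ` is in the centroid and `κ` is symmetric and invariant, then `κ(χ x, y)` is invariant. -/
theorem IsInvariantBilin.comp_centroid {κ : LinearMap.BilinForm k L} (hκ : IsInvariantBilin κ)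
    (hs : ∀ x y, κ x y = κ y x) {χ : L →ₗ[k] L} (hχ : χ ∈ lieCentroid k L) :
    IsInvariantBilin (κ ∘ₗ χ) := by
  intro a b c
  simp only [LinearMap.comp_apply]
  refine ⟨by rw [(hχ a b).2, (hκ _ _ _).1], ?_⟩
  -- The centroid moves `χ` across the bracket: `κ(χa,[b,c]) = κ([χa,b],c) = κ([a,χb],c)`; symmetry
  -- and invariance give `κ(χb,[c,a])`.
  rw [← (hκ (χ a) b c).1, ← (hχ a b).2, (hχ a b).1, hs, hs _ ⁅c, a⁆, (hκ c a (χ b)).1]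

/-- On a perfect algebra every invariant biadditive map is balanced over the centroid. -/
theorem IsInvariantBilin.balanced {k R L V : Type*} [CommRing k] [CommRing R] [LieRing L]
    [LieAlgebra R L] [Module k L] [AddCommGroup V] [Module k V] (hL : IsPerfectLie R L)
    {γ : L →ₗ[k] L →ₗ[k] V} (hγ : IsInvariantBilin γ) (r : R) (x y : L) :
    γ (r • x) y = γ x (r • y) := by
  have hx : x ∈ Submodule.span R {x : L | ∃ a b : L, x = ⁅a, b⁆} := by
    rw [show Submodule.span R {x : L | ∃ a b : L, x = ⁅a, b⁆} = ⊤ from hL]; trivial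
  induction hx using Submodule.span_induction generalizing r y with
  | zero => simp
  | add a b _ _ ha hb => simp [ha, hb]
  | smul s a _ ha => rw [smul_smul, ha, ha, mul_comm, mul_smul]
  | mem x hx =>
    obtain ⟨a, b, rfl⟩ := hx
    -- Both sides equal `γ(b, [r y, a])`: the cyclic identity puts `a` and `y` into one bracket,
    -- where `r` passes between them.
    rw [← smul_lie, (hγ (r • a) b y).1, (hγ (r • a) b y).2, lie_smul, ← smul_lie,
      (hγ a b (r • y)).1, (hγ a b (r • y)).2]

end Invariant

/-! ### Semisimple Lie algebras over a field -/

section Field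

variable {k 𝔤 : Type*} [Field k] [LieRing 𝔤] [LieAlgebra k 𝔤] [Module.Finite k 𝔤]
  [LieAlgebra.IsKilling k 𝔤]

omit [Module.Finite k 𝔤] in
theorem killingForm_eq_zero_of_forall {x : 𝔤} (h : ∀ y, killingForm k 𝔤 x y = 0) : x = 0 :=
  (LieAlgebra.IsKilling.killingForm_nondegenerate k 𝔤).1 x h

/-- A functional vanishing on all brackets is `κ(z, -)` for some `z`. Invariance gives `κ([z,a],b) =
κ(z,[a,b]) = 0`, so `ad z = 0`, and then `κ(z, -) = 0`. -/
theorem isPerfectLie_of_isKilling : IsPerfectLie k 𝔤 := by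
  by_contra h
  obtain ⟨f, hf, hle⟩ := Submodule.exists_le_ker_of_lt_top _ (lt_top_iff_ne_top.mpr h)
  apply hf
  let e := (killingForm k 𝔤).toDual (LieAlgebra.IsKilling.killingForm_nondegenerate k 𝔤)
  have he : ∀ x, killingForm k 𝔤 (e.symm f) x = f x := fun x =>
    LinearMap.BilinForm.apply_toDual_symm_apply
      (hB := LieAlgebra.IsKilling.killingForm_nondegenerate k 𝔤) f x
  have hz : ∀ a : 𝔤, ⁅e.symm f, a⁆ = 0 := fun a => killingForm_eq_zero_of_forall fun b => by
    rw [(isInvariantBilin_killingForm (k := k) _ _ _).1, he]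
    exact hle (Submodule.subset_span ⟨a, b, rfl⟩)
  have h0 : e.symm f = 0 := killingForm_eq_zero_of_forall fun b => by
    have : LieAlgebra.ad k 𝔤 (e.symm f) = 0 := by ext a; exact hz a
    rw [killingForm_apply_apply, this, LinearMap.zero_comp, map_zero]
  simpa using h0

/-- Nondegeneracy defines `χ` by `κ(χ x, -) = β(x, -)`; comparing the invariance of `β` and of `κ`
puts `χ` in the centroid. -/
theorem exists_mem_lieCentroid_of_invariant {β : LinearMap.BilinForm k 𝔤}
    (hβ : IsInvariantBilin β) : ∃ χ ∈ lieCentroid k 𝔤, β = killingForm k 𝔤 ∘ₗ χ := by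
  let e := (killingForm k 𝔤).toDual (LieAlgebra.IsKilling.killingForm_nondegenerate k 𝔤)
  let χ : 𝔤 →ₗ[k] 𝔤 := e.symm.toLinearMap ∘ₗ β
  have hχ : ∀ x y, killingForm k 𝔤 (χ x) y = β x y := fun x y =>
    LinearMap.BilinForm.apply_toDual_symm_apply
      (hB := LieAlgebra.IsKilling.killingForm_nondegenerate k 𝔤) (β x) y
  have hκ := isInvariantBilin_killingForm (k := k) (L := 𝔤)
  refine ⟨χ, fun a b => ⟨?_, ?_⟩, by ext x y; exact (hχ x y).symm⟩
  · refine sub_eq_zero.mp (killingForm_eq_zero_of_forall (k := k) fun c => ?_)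
    rw [map_sub, LinearMap.sub_apply, sub_eq_zero, hχ, (hβ a b c).1, (hβ a b c).2, ← hχ,
      (hκ a (χ b) c).1, (hκ a (χ b) c).2]
  · refine sub_eq_zero.mp (killingForm_eq_zero_of_forall (k := k) fun c => ?_)
    rw [map_sub, LinearMap.sub_apply, sub_eq_zero, hχ, (hβ a b c).1, ← hχ, (hκ (χ a) b c).1]

theorem toLieCentroid_apply (R : Type*) {L : Type*} [CommRing R] [LieRing L]
    [LieAlgebra R L] (r : R) (x : L) :
    (toLieCentroid R L r : L →ₗ[R] L) x = r • x := rfl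

theorem IsCentralLie.exists_smul {R L : Type*} [CommRing R] [LieRing L] [LieAlgebra R L]
    (h : IsCentralLie R L) {χ : L →ₗ[R] L} (hχ : χ ∈ lieCentroid R L) :
    ∃ r : R, ∀ x, χ x = r • x := by
  obtain ⟨r, hr⟩ := h.2 ⟨χ, hχ⟩
  exact ⟨r, fun x => by rw [← toLieCentroid_apply, hr]⟩

theorem IsCentralLie.nontrivial {R L : Type*} [CommRing R] [Nontrivial R] [LieRing L]
    [LieAlgebra R L] (h : IsCentralLie R L) : Nontrivial L := by
  by_contra hL
  rw [not_nontrivial_iff_subsingleton] at hL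
  exact zero_ne_one (h.1 (Subsingleton.elim (toLieCentroid R L 0) (toLieCentroid R L 1)))

omit [Module.Finite k 𝔤] in
theorem IsCentralLie.exists_killingForm_eq_one (h : IsCentralLie k 𝔤) :
    ∃ x y, killingForm k 𝔤 x y = 1 := by
  have := h.nontrivial
  obtain ⟨x, hx⟩ := exists_ne (0 : 𝔤)
  have : ∃ y, killingForm k 𝔤 x y ≠ 0 := by
    by_contra! hy
    exact hx (killingForm_eq_zero_of_forall hy)
  obtain ⟨y, hy⟩ := this
  exact ⟨x, (killingForm k 𝔤 x y)⁻¹ • y, by simp [hy]⟩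

/-- Vector-valued invariant bilinear maps on a central algebra are multiples of the Killing form. -/
theorem IsCentralLie.invariant_eq_smul (h : IsCentralLie k 𝔤) {W : Type*} [AddCommGroup W]
    [Module k W] {γ : 𝔤 →ₗ[k] 𝔤 →ₗ[k] W} (hγ : IsInvariantBilin γ) :
    ∃ w : W, ∀ x y, γ x y = killingForm k 𝔤 x y • w := by
  obtain ⟨x₀, y₀, h₁⟩ := h.exists_killingForm_eq_one
  -- Since `κ(x₀, y₀) = 1`, no other vector is possible. Functionals on `W` separate points, which
  -- reduces to scalar forms.
  refine ⟨γ x₀ y₀, fun x y => sub_eq_zero.mp ?_⟩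
  rw [← Module.forall_dual_apply_eq_zero_iff k]
  intro f
  obtain ⟨χ, hχ, hf⟩ := exists_mem_lieCentroid_of_invariant (k := k) (β := γ.compr₂ f)
    fun a b c => by simp only [LinearMap.compr₂_apply, (hγ a b c).1, (hγ a b c).2, and_self]
  obtain ⟨c, hc⟩ := h.exists_smul hχ
  have key : ∀ x y, f (γ x y) = c * killingForm k 𝔤 x y := fun x y => by
    have := LinearMap.congr_fun₂ hf x y
    simpa [hc] using this
  simp [key, h₁, mul_comm]

/-- The projection onto an ideal along its Killing complement lies in the centroid, so it is a
scalar; if the ideal is nonzero, the scalar is `1`. -/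
theorem IsCentralLie.isSimple (h : IsCentralLie k 𝔤) : LieAlgebra.IsSimple k 𝔤 where
  non_abelian hab := by
    have := h.nontrivial
    rw [LieAlgebra.IsKilling.isLieAbelian_iff_subsingleton k] at hab
    exact not_subsingleton 𝔤 hab
  eq_bot_or_eq_top I := by
    have hc := I.isCompl_killingCompl
    have hc' : IsCompl I.toSubmodule I.killingCompl.toSubmodule :=
      (LieSubmodule.isCompl_toSubmodule ..).mpr hc
    let π := I.toSubmodule.projection _ hc'
    have hπ : ∀ a b : 𝔤, π ⁅a, b⁆ = ⁅a, π b⁆ := fun a b => by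
      have h₁ : ⁅a, b⁆ = ⁅a, π b⁆ + ⁅a, b - π b⁆ := by rw [← lie_add, add_sub_cancel]
      rw [h₁, map_add]
      have h₂ : π ⁅a, π b⁆ = ⁅a, π b⁆ :=
        (Submodule.projection_eq_self_iff hc' _).mpr
          (I.lie_mem (Submodule.projection_apply_mem hc' b))
      have h₃ : π ⁅a, b - π b⁆ = 0 :=
        (Submodule.projection_apply_eq_zero_iff hc').mpr
          (I.killingCompl.lie_mem (Submodule.sub_projection_mem hc' b))
      rw [h₂, h₃, add_zero]
    have hπc : π ∈ lieCentroid k 𝔤 := fun a b =>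
      ⟨hπ a b, by rw [← lie_skew, map_neg, hπ, lie_skew]⟩
    obtain ⟨c, hc⟩ := h.exists_smul hπc
    refine or_iff_not_imp_left.mpr fun hI => ?_
    obtain ⟨x, hx, hx0⟩ : ∃ (x : 𝔤) (_ : x ∈ I), x ≠ 0 := by
      simpa [LieSubmodule.eq_bot_iff] using hI
    have hx' : c • x = x := by
      rw [← hc]
      exact (Submodule.projection_eq_self_iff hc' x).mpr hx
    have hc1 : c = 1 := smul_left_injective k hx0 (by simpa using hx')
    refine eq_top_iff.mpr fun y _ => ?_
    rw [← one_smul k y, ← hc1, ← hc]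
    exact Submodule.projection_apply_mem hc' y

end Field

/-! ### Perfect algebras and base change -/

section Perfect

variable {R L : Type*} [CommRing R] [LieRing L] [LieAlgebra R L]

theorem IsPerfectLie.of_surjective {L' : Type*} [LieRing L'] [LieAlgebra R L']
    (h : IsPerfectLie R L) (f : L →ₗ⁅R⁆ L') (hf : Function.Surjective f) : IsPerfectLie R L' := by
  have hf' : LinearMap.range (f : L →ₗ[R] L') = ⊤ := LinearMap.range_eq_top.mpr hf
  rw [IsPerfectLie, eq_top_iff, ← hf', LinearMap.range_eq_map, ← h, Submodule.map_span,
    Submodule.span_le]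
  rintro _ ⟨_, ⟨a, b, rfl⟩, rfl⟩
  exact Submodule.subset_span ⟨f a, f b, LieHom.map_lie f a b⟩

theorem IsPerfectLie.baseChange (h : IsPerfectLie R L) (T : Type*) [CommRing T] [Algebra R T] :
    IsPerfectLie T (T ⊗[R] L) := by
  rw [IsPerfectLie, eq_top_iff, ← Submodule.baseChange_top (R := R) (M := L), ← h,
    Submodule.baseChange_span, Submodule.span_le]
  rintro _ ⟨_, ⟨a, b, rfl⟩, rfl⟩
  exact Submodule.subset_span ⟨1 ⊗ₜ a, 1 ⊗ₜ b, by simp⟩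

theorem lie_mem_baseChange_span (T : Type*) [CommRing T] [Algebra R T] (u v : T ⊗[R] L) :
    ⁅u, v⁆ ∈ (Submodule.span R {x : L | ∃ a b : L, x = ⁅a, b⁆}).baseChange T := by
  induction u with
  | zero => simp
  | add u u' h h' => rw [add_lie]; exact add_mem h h'
  | tmul r x =>
    induction v with
    | zero => simp
    | add v v' h h' => rw [lie_add]; exact add_mem h h'
    | tmul s y =>
      exact Submodule.tmul_mem_baseChange_of_mem _ (Submodule.subset_span ⟨x, y, rfl⟩)

/-- Brackets of `S ⊗ L` lie in the base change of the span of brackets of `L`, so the inclusion of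
that span becomes surjective over `S`. -/
theorem IsPerfectLie.of_faithfullyFlat (S : Type*) [CommRing S] [Algebra R S]
    [Module.FaithfullyFlat R S] (h : IsPerfectLie S (S ⊗[R] L)) : IsPerfectLie R L := by
  have htop : (Submodule.span R {x : L | ∃ a b : L, x = ⁅a, b⁆}).baseChange S = ⊤ := by
    rw [eq_top_iff, ← h, Submodule.span_le]
    rintro _ ⟨u, v, rfl⟩
    exact lie_mem_baseChange_span S u v
  rw [IsPerfectLie, ← Submodule.range_subtype (Submodule.span R _), LinearMap.range_eq_top,
    ← Module.FaithfullyFlat.lTensor_surjective_iff_surjective R S]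
  rw [Submodule.baseChange, LinearMap.range_eq_top] at htop
  exact htop

end Perfect

/-! ### Nonsingular forms and faithfully flat descent -/

/-- For `M` finitely presented and `T` flat, dualizing commutes with base change; under this
identification the map of `β_T` into the dual is `T ⊗ β`. -/
theorem isNonsingular_baseChange_iff {R M : Type*} [CommRing R] [AddCommGroup M] [Module R M]
    [Module.FinitePresentation R M] (β : LinearMap.BilinForm R M)
    (T : Type*) [CommRing T] [Algebra R T] [Module.Flat R T] :
    IsNonsingular (β.baseChange T) ↔ Function.Bijective (LinearMap.lTensor T β) := by
  let c : T ⊗[R] Module.Dual R M ≃ₗ[T] Module.Dual T (T ⊗[R] M) :=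
    (Module.FinitePresentation.isBaseChange_map R M R T).equiv ≪≫ₗ
      (TensorProduct.AlgebraTensorModule.rid R T T).congrRight
  have hcomp : (fun z => (β.baseChange T z : Module.Dual T (T ⊗[R] M))) =
      c ∘ LinearMap.lTensor T β := by
    funext z
    induction z with
    | zero => simp
    | add z z' h h' => simp only [Function.comp_apply, map_add] at h h' ⊢; rw [h, h']
    | tmul s x =>
      ext y
      have hr : ∀ f : T ⊗[R] M →ₗ[T] T ⊗[R] R, (TensorProduct.AlgebraTensorModule.rid R T
        T).congrRight f (1 ⊗ₜ y) = TensorProduct.AlgebraTensorModule.rid R T T (f (1 ⊗ₜ y)) :=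
        fun _ => rfl
      simp [c, IsBaseChange.equiv_tmul, hr]
  rw [IsNonsingular, hcomp, Function.Bijective.of_comp_iff' c.bijective]

/-- A bilinear form on a finitely presented module is nonsingular if its base change to
a faithfully flat algebra is. -/
theorem IsNonsingular.of_faithfullyFlat {R M : Type*} [CommRing R] [AddCommGroup M] [Module R M]
    [Module.FinitePresentation R M] {β : LinearMap.BilinForm R M}
    (S : Type*) [CommRing S] [Algebra R S] [Module.FaithfullyFlat R S]
    (h : IsNonsingular (β.baseChange S)) : IsNonsingular β :=
  (Module.FaithfullyFlat.lTensor_bijective_iff_bijective R S β).mp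
    ((isNonsingular_baseChange_iff β S).mp h)

theorem IsNonsingular.baseChange {R M : Type*} [CommRing R] [AddCommGroup M] [Module R M]
    [Module.FinitePresentation R M] {β : LinearMap.BilinForm R M} (h : IsNonsingular β)
    (T : Type*) [CommRing T] [Algebra R T] [Module.Flat R T] :
    IsNonsingular (β.baseChange T) :=
  (isNonsingular_baseChange_iff β T).mpr (LinearEquiv.lTensor T (.ofBijective β h)).bijective

/-! ### Realizations -/

theorem IsRealization.exists_lieEquiv {k R T 𝔤 B : Type*} [CommRing k] [CommRing R] [CommRing T]
    [Algebra k R] [Algebra k T] [Algebra R T] [IsScalarTower k R T]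
    [LieRing 𝔤] [LieAlgebra k 𝔤] [LieRing B] [LieAlgebra R B] {ι : B →ₗ[R] T ⊗[k] 𝔤}
    (hι : IsRealization ι) : ∃ θ : (T ⊗[R] B) ≃ₗ⁅T⁆ (T ⊗[k] 𝔤), ∀ b, θ (1 ⊗ₜ b) = ι b := by
  refine ⟨{ hι.isBaseChange.equiv with map_lie' := ?_ }, fun b => ?_⟩
  · intro x y
    change hι.isBaseChange.equiv ⁅x, y⁆ = ⁅hι.isBaseChange.equiv x, hι.isBaseChange.equiv y⁆
    induction x with
    | zero => simp
    | add x x' h h' => simp only [add_lie, map_add, h, h']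
    | tmul r x =>
      induction y with
      | zero => simp
      | add y y' h h' => simp only [lie_add, map_add, h, h']
      | tmul s y => simp [IsBaseChange.equiv_tmul, hι.map_lie, mul_smul, smul_comm r s]
  · exact (hι.isBaseChange.equiv_tmul 1 b).trans (one_smul _ _)

/-! ### The Killing form of a twisted form -/

section TwistedForm

variable {k R 𝔤 B : Type*} [Field k] [CommRing R]
  [LieRing 𝔤] [LieAlgebra k 𝔤] [Module.Finite k 𝔤] [LieRing B] [LieAlgebra R B]

section

variable (S : Type*) [CommRing S] [Algebra k S] [Algebra R S] [Module.FaithfullyFlat R S]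

theorem IsSplitBy.finite (h : IsSplitBy k R S 𝔤 B) : Module.Finite R B := by
  obtain ⟨θ⟩ := h
  have : Module.Finite S (S ⊗[R] B) := Module.Finite.equiv θ.symm.toLinearEquiv
  exact Module.Finite.of_finite_tensorProduct_of_faithfullyFlat S

theorem IsSplitBy.projective (h : IsSplitBy k R S 𝔤 B) : Module.Projective R B := by
  obtain ⟨θ⟩ := h
  have : Module.Finite S (S ⊗[R] B) := Module.Finite.equiv θ.symm.toLinearEquiv
  have : Module.Projective S (S ⊗[R] B) := Module.Projective.of_equiv θ.symm.toLinearEquiv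
  exact Module.Projective.of_faithfullyFlat_baseChange S B

theorem IsSplitBy.isPerfectLie [LieAlgebra.IsKilling k 𝔤] (h : IsSplitBy k R S 𝔤 B) :
    IsPerfectLie R B := by
  obtain ⟨θ⟩ := h
  exact .of_faithfullyFlat S <| ((isPerfectLie_of_isKilling (k := k)).baseChange S).of_surjective
    (θ.symm : S ⊗[k] 𝔤 →ₗ⁅S⁆ S ⊗[R] B) θ.symm.surjective

end

variable [Module.Finite R B] [Module.Projective R B]

/-- The bridge for all descent arguments. No flatness of `T` is needed. -/
theorem projKillingForm_baseChange_of_equiv {T : Type*} [CommRing T] [Algebra k T] [Algebra R T]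
    (θ : (T ⊗[R] B) ≃ₗ⁅T⁆ (T ⊗[k] 𝔤)) (x y : T ⊗[R] B) :
    (projKillingForm R B).baseChange T x y = killingForm T (T ⊗[k] 𝔤) (θ x) (θ y) := by
  rw [← projKillingForm_baseChange, ← projKillingForm_eq_killingForm, projKillingForm_of_equiv]

theorem algebraMap_projKillingForm {T : Type*} [CommRing T] [Algebra k T] [Algebra R T]
    (θ : (T ⊗[R] B) ≃ₗ⁅T⁆ (T ⊗[k] 𝔤)) (x y : B) :
    algebraMap R T (projKillingForm R B x y) =
      killingForm T (T ⊗[k] 𝔤) (θ (1 ⊗ₜ x)) (θ (1 ⊗ₜ y)) := by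
  rw [← projKillingForm_baseChange_of_equiv]
  simp [Algebra.algebraMap_eq_smul_one]

theorem isAutInvariant_projKillingForm : IsAutInvariant (projKillingForm R B) := by
  intro T _ _ f x y
  rw [← projKillingForm_baseChange, projKillingForm_of_equiv]

variable {S : Type*} [CommRing S] [Algebra k S] [Algebra R S] [Module.FaithfullyFlat R S]
  (θ : (S ⊗[R] B) ≃ₗ⁅S⁆ (S ⊗[k] 𝔤))

include θ

theorem projKillingForm_comm_of_equiv (x y : B) :
    projKillingForm R B x y = projKillingForm R B y x := by
  apply FaithfulSMul.algebraMap_injective R S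
  rw [algebraMap_projKillingForm θ, algebraMap_projKillingForm θ, LieModule.traceForm_comm]

theorem isInvariantBilin_projKillingForm_of_equiv : IsInvariantBilin (projKillingForm R B) := by
  intro a b c
  have hθ : ∀ x y : B, θ (1 ⊗ₜ ⁅x, y⁆) = ⁅θ (1 ⊗ₜ x), θ (1 ⊗ₜ y)⁆ := fun x y => by
    rw [← LieEquiv.map_lie]; simp
  have h := isInvariantBilin_killingForm (k := S) (θ (1 ⊗ₜ a)) (θ (1 ⊗ₜ b)) (θ (1 ⊗ₜ c))
  constructor <;> apply FaithfulSMul.algebraMap_injective R S <;>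
    simp only [algebraMap_projKillingForm θ, hθ, h.1, h.2]

/-- Nonsingularity passes from `k` up to `S ⊗ 𝔤`, across `θ` to `S ⊗ B`, and down to `B`. -/
theorem isNonsingular_projKillingForm_of_equiv [LieAlgebra.IsKilling k 𝔤] :
    IsNonsingular (projKillingForm R B) := by
  have : Module.FinitePresentation R B := Module.finitePresentation_of_projective _ _
  apply IsNonsingular.of_faithfullyFlat S
  have h : IsNonsingular (killingForm S (S ⊗[k] 𝔤)) := by
    rw [killingForm, LieModule.traceForm_baseChange]
    have : Module.FinitePresentation k 𝔤 := Module.finitePresentation_of_projective _ _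
    exact IsNonsingular.baseChange
      ((killingForm k 𝔤).toDual (LieAlgebra.IsKilling.killingForm_nondegenerate k 𝔤)).bijective S
  constructor
  · intro x y hxy
    apply θ.injective
    apply h.1
    refine LinearMap.ext fun z => ?_
    have := LinearMap.congr_fun hxy (θ.symm z)
    simpa [projKillingForm_baseChange_of_equiv θ] using this
  · intro f
    obtain ⟨z, hz⟩ := h.2 (f ∘ₗ θ.symm.toLinearEquiv.toLinearMap)
    refine ⟨θ.symm z, LinearMap.ext fun y => ?_⟩
    have := LinearMap.congr_fun hz (θ y)
    simpa [projKillingForm_baseChange_of_equiv θ] using this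

end TwistedForm

/-! ### The IBF-principle -/

section IBF

variable {R L : Type*} [CommRing R] [LieRing L] [LieAlgebra R L]

/-- The universal invariant bilinear map. -/
def universalForm (R L : Type*) [CommRing R] [LieRing L] [LieAlgebra R L] :
    LinearMap.BilinMap R L (UniversalIBF R L) :=
  (TensorProduct.mk R L L).compr₂ (ibfRelations R L).mkQ

theorem isInvariantBilin_universalForm : IsInvariantBilin (universalForm R L) := by
  intro a b c
  have h₁ : universalForm R L ⁅a, b⁆ c = universalForm R L a ⁅b, c⁆ :=
    (Submodule.Quotient.eq _).mpr (Submodule.subset_span ⟨a, b, c, Or.inl rfl⟩)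
  have h₂ : universalForm R L ⁅a, b⁆ c = universalForm R L b ⁅c, a⁆ :=
    (Submodule.Quotient.eq _).mpr (Submodule.subset_span ⟨a, b, c, Or.inr rfl⟩)
  exact ⟨h₁, h₁.symm.trans h₂⟩

theorem mem_ibfRelations_of_lift_eq_zero {β : invariantForms R L}
    (hβ : Function.Injective (inducedMap β)) {t : L ⊗[R] L}
    (ht : TensorProduct.lift (β : LinearMap.BilinForm R L) t = 0) : t ∈ ibfRelations R L := by
  rw [← Submodule.Quotient.mk_eq_zero]
  exact hβ (ht.trans (map_zero _).symm)

theorem exists_lift_eq_one {β : invariantForms R L}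
    (hβ : Function.Surjective (inducedMap β)) :
    ∃ t : L ⊗[R] L, TensorProduct.lift (β : LinearMap.BilinForm R L) t = 1 := by
  obtain ⟨u, hu⟩ := hβ 1
  obtain ⟨t, rfl⟩ := Submodule.mkQ_surjective _ u
  exact ⟨t, hu⟩

/-- If `𝐈𝐁𝐅_R(L) → R` is an isomorphism and `L` is perfect, then every invariant `k`-bilinear map
factors uniquely through the given form. -/
theorem existsUnique_comp_form {k V : Type*} [CommRing k] [Algebra k R] [Module k L]
    [IsScalarTower k R L] [AddCommGroup V] [Module k V] (hL : IsPerfectLie R L)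
    {β : invariantForms R L} (hβ : Function.Bijective (inducedMap β))
    {γ : L →ₗ[k] L →ₗ[k] V} (hγ : IsInvariantBilin γ) :
    ∃! φ : R →ₗ[k] V, ∀ x y : L, γ x y = φ ((β : LinearMap.BilinForm R L) x y) := by
  obtain ⟨t₁, ht₁⟩ := exists_lift_eq_one hβ.2
  -- `V` has no `R`-action, so `γ` extends to the tensor product over `R` only additively, using
  -- that it is balanced.
  let g : L ⊗[R] L →+ V := TensorProduct.liftAddHom
    (AddMonoidHom.mk' (fun x => (γ x).toAddMonoidHom) fun x y => by ext; simp)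
    fun r x y => hγ.balanced hL r x y
  have hg : ∀ x y, g (x ⊗ₜ y) = γ x y := fun x y => rfl
  -- As `g` is not `R`-linear, all `R`-multiples must be treated at once; on a generating relation,
  -- `r` is absorbed by replacing `a` with `r a`.
  have hrel : ∀ t ∈ ibfRelations R L, ∀ r : R, g (r • t) = 0 := by
    intro t ht
    induction ht using Submodule.span_induction with
    | zero => simp
    | add t u _ _ ht hu => intro r; rw [smul_add, map_add, ht, hu, add_zero]
    | smul s t _ ht => intro r; rw [smul_smul, ht]
    | mem t ht =>
      intro r
      obtain ⟨a, b, c, rfl | rfl⟩ := ht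
      · rw [smul_sub, TensorProduct.smul_tmul', TensorProduct.smul_tmul', map_sub, hg, hg,
          ← smul_lie, (hγ _ _ _).1, sub_self]
      · rw [smul_sub, TensorProduct.smul_tmul', ← TensorProduct.tmul_smul, map_sub, hg, hg,
          ← smul_lie, ← lie_smul, (hγ _ _ _).1, (hγ _ _ _).2, sub_self]
  have hk : ∀ (c : k) t, g (algebraMap k R c • t) = c • g t := by
    intro c t
    induction t with
    | zero => simp
    | add t u ht hu => rw [smul_add, map_add, map_add, smul_add, ht, hu]
    | tmul x y =>
      rw [TensorProduct.smul_tmul', hg, hg, algebraMap_smul, map_smul, LinearMap.smul_apply]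
  -- The form takes `r • t₁` to `r`, which forces this choice.
  let φ : R →ₗ[k] V :=
    { toFun := fun r => g (r • t₁)
      map_add' := fun r s => by rw [add_smul, map_add]
      map_smul' := fun c r => by
        rw [RingHom.id_apply, ← hk, Algebra.smul_def, mul_smul] }
  refine ⟨φ, fun x y => ?_, fun ψ hψ => ?_⟩
  · have hmem : x ⊗ₜ y - ((β : LinearMap.BilinForm R L) x y) • t₁ ∈ ibfRelations R L := by
      apply mem_ibfRelations_of_lift_eq_zero hβ.1
      simp [ht₁]
    have := hrel _ hmem 1
    rw [one_smul, map_sub, sub_eq_zero] at this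
    exact this
  · have hall : ∀ t, ψ (TensorProduct.lift (β : LinearMap.BilinForm R L) t) = g t := by
      intro t
      induction t with
      | zero => simp
      | add t u ht hu => rw [map_add, map_add, map_add, ht, hu]
      | tmul x y => rw [hg, hψ, TensorProduct.lift.tmul]
    ext r
    change ψ r = g (r • t₁)
    rw [← hall, map_smul, ht₁, smul_eq_mul, mul_one]

theorem satisfiesIBFPrinciple_of_bijective.{v} {k : Type*} [CommRing k] [Algebra k R] [Module k L]
    [IsScalarTower k R L] (hL : IsPerfectLie R L) {β : LinearMap.BilinForm R L}
    (hβ : β ∈ invariantForms R L) (h : Function.Bijective (inducedMap ⟨β, hβ⟩)) :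
    SatisfiesIBFPrinciple.{v} k β := by
  refine ⟨hβ, h, fun V _ _ => ⟨⟨fun φ ψ hφψ => ?_, fun γ => ?_⟩, fun r φ => ?_⟩⟩
  · refine (existsUnique_comp_form hL h (compForm k V ⟨β, hβ⟩ φ).2.1).unique (fun x y => rfl) ?_
    intro x y
    rw [hφψ]
    rfl
  · obtain ⟨φ, hφ, -⟩ := existsUnique_comp_form hL h γ.2.1
    refine ⟨φ, Subtype.ext ?_⟩
    ext x y
    exact (hφ x y).symm
  · refine Subtype.ext ?_
    ext x y
    change φ (r * β x y) = φ (β (r • x) y)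
    simp

theorem exists_eq_smul_of_bijective (hL : IsPerfectLie R L) {β : invariantForms R L}
    (hβ : Function.Bijective (inducedMap β)) {γ : LinearMap.BilinForm R L}
    (hγ : IsInvariantBilin γ) : ∃ r : R, γ = r • (β : LinearMap.BilinForm R L) := by
  -- Here `k` is `R` itself, so `φ` is multiplication by `φ 1`.
  obtain ⟨φ, hφ, -⟩ := existsUnique_comp_form hL hβ hγ
  refine ⟨φ 1, ?_⟩
  ext x y
  rw [hφ, ← mul_one ((β : LinearMap.BilinForm R L) x y), ← smul_eq_mul, map_smul]
  simp [mul_comm]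

theorem eq_of_smul_eq_smul {β : invariantForms R L} (hβ : Function.Surjective (inducedMap β))
    {r s : R} (h : r • (β : LinearMap.BilinForm R L) = s • (β : LinearMap.BilinForm R L)) :
    r = s := by
  obtain ⟨t, ht⟩ := exists_lift_eq_one hβ
  have : r • TensorProduct.lift (β : LinearMap.BilinForm R L) =
      s • TensorProduct.lift (β : LinearMap.BilinForm R L) := by
    ext x y
    simpa using LinearMap.congr_fun₂ h x y
  simpa [ht] using LinearMap.congr_fun this t

theorem exists_basis_invariantForms (hL : IsPerfectLie R L) {β : invariantForms R L}
    (hβ : Function.Bijective (inducedMap β)) :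
    ∃ b : Module.Basis Unit R (invariantForms R L), b () = β := by
  have hbij : Function.Bijective (LinearMap.toSpanSingleton R (invariantForms R L) β) := by
    refine ⟨fun r s hrs => eq_of_smul_eq_smul hβ.2 (congrArg Subtype.val hrs), fun γ => ?_⟩
    obtain ⟨r, hr⟩ := exists_eq_smul_of_bijective hL hβ γ.2
    exact ⟨r, Subtype.ext hr.symm⟩
  exact ⟨(Module.Basis.singleton Unit R).map (LinearEquiv.ofBijective _ hbij), by simp⟩

/-- For `χ` in the centroid, `β(χ x, y)` is again invariant, hence equals `r β(x, y)`, and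
nonsingularity gives `χ x = r x`. -/
theorem isCentralLie_of_bijective (hL : IsPerfectLie R L) {β : invariantForms R L}
    (hβ : Function.Bijective (inducedMap β)) (hs : ∀ x y : L, β.1 x y = β.1 y x)
    (hn : IsNonsingular β.1) : IsCentralLie R L := by
  refine ⟨fun r s hrs => eq_of_smul_eq_smul hβ.2 ?_, fun χ => ?_⟩
  · ext x y
    have : r • x = s • x := by rw [← toLieCentroid_apply, hrs, toLieCentroid_apply]
    simp only [← LinearMap.map_smul₂, LinearMap.smul_apply]
    simpa using congrArg (fun z => β.1 z y) this
  · obtain ⟨r, hr⟩ := exists_eq_smul_of_bijective hL hβ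
      (IsInvariantBilin.comp_centroid β.2 hs χ.2)
    refine ⟨r, Subtype.ext (LinearMap.ext fun x => hn.1 ?_)⟩
    change β.1 (r • x) = (β.1 ∘ₗ χ.1) x
    rw [hr, map_smul, LinearMap.smul_apply]

end IBF

/-! ### Invariant bilinear maps on twisted forms of central algebras -/

section TwistedForm

variable {k R 𝔤 B S : Type*} [Field k] [CommRing R] [LieRing 𝔤] [LieAlgebra k 𝔤]
  [Module.Finite k 𝔤] [LieAlgebra.IsKilling k 𝔤] [LieRing B] [LieAlgebra R B]
  [Module.Finite R B] [Module.Projective R B]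
  [CommRing S] [Algebra k S] [Algebra R S]

/-- Restricting `β_S` along `θ⁻¹` to `1 ⊗ 𝔤` gives an invariant `k`-bilinear map into `S ⊗ U`, a
multiple of `κ` by the field case; `S`-bilinearity extends this. A general `U` is needed for the
universal map. -/
theorem IsCentralLie.baseChange_eq_smul (h𝔤 : IsCentralLie k 𝔤)
    (θ : (S ⊗[R] B) ≃ₗ⁅S⁆ (S ⊗[k] 𝔤)) {U : Type*} [AddCommGroup U] [Module R U]
    {β : LinearMap.BilinMap R B U} (hβ : IsInvariantBilin β) :
    ∃ w : S ⊗[R] U, ∀ x y : S ⊗[R] B,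
      β.baseChange S x y = (projKillingForm R B).baseChange S x y • w := by
  have hθk : ∀ (c : k) (x : 𝔤), θ.symm (1 ⊗ₜ (c • x)) = algebraMap k S c • θ.symm (1 ⊗ₜ x) :=
    fun c x => by
      rw [← map_smul, TensorProduct.tmul_smul, algebraMap_smul]
  let γ : 𝔤 →ₗ[k] 𝔤 →ₗ[k] S ⊗[R] U := LinearMap.mk₂ k
    (fun x y => β.baseChange S (θ.symm (1 ⊗ₜ x)) (θ.symm (1 ⊗ₜ y)))
    (fun x x' y => by simp only [TensorProduct.tmul_add, map_add, LinearMap.add_apply])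
    (fun c x y => by rw [hθk, map_smul, LinearMap.smul_apply, algebraMap_smul])
    (fun x y y' => by simp only [TensorProduct.tmul_add, map_add])
    (fun c x y => by rw [hθk, map_smul, algebraMap_smul])
  have hθ : ∀ x y : 𝔤, θ.symm (1 ⊗ₜ ⁅x, y⁆) = ⁅θ.symm (1 ⊗ₜ x), θ.symm (1 ⊗ₜ y)⁆ := fun x y => by
    rw [← LieEquiv.map_lie]; simp
  have hγ : IsInvariantBilin γ := fun a b c => by
    simpa only [γ, LinearMap.mk₂_apply, hθ] using hβ.baseChange S _ _ _
  obtain ⟨w, hw⟩ := h𝔤.invariant_eq_smul hγ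
  have key : ∀ u v : S ⊗[k] 𝔤, β.baseChange S (θ.symm u) (θ.symm v) =
      killingForm S (S ⊗[k] 𝔤) u v • w := by
    intro u v
    rw [killingForm, LieModule.traceForm_baseChange]
    induction u with
    | zero => simp
    | add u u' h h' => simp only [map_add, LinearMap.add_apply, h, h', add_smul]
    | tmul s x =>
      induction v with
      | zero => simp
      | add v v' h h' => simp only [map_add, h, h', add_smul]
      | tmul t y =>
        have := hw x y
        simp only [γ, LinearMap.mk₂_apply] at this
        rw [← mul_one s, ← mul_one t, ← smul_eq_mul, ← smul_eq_mul t, ← TensorProduct.smul_tmul',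
          ← TensorProduct.smul_tmul']
        simp only [map_smul, LinearMap.smul_apply, this]
        simp only [LinearMap.BilinForm.baseChange_tmul, smul_smul, smul_eq_mul, mul_one]
        rw [mul_smul_comm, mul_one, mul_smul_comm, smul_assoc]
        exact smul_comm (t * s) _ w
  refine ⟨w, fun x y => ?_⟩
  rw [projKillingForm_baseChange_of_equiv θ, ← key, LieEquiv.symm_apply_apply,
    LieEquiv.symm_apply_apply]

variable [Module.FaithfullyFlat R S]

theorem IsCentralLie.bijective_inducedMap (h𝔤 : IsCentralLie k 𝔤)
    (θ : (S ⊗[R] B) ≃ₗ⁅S⁆ (S ⊗[k] 𝔤)) (hκ : projKillingForm R B ∈ invariantForms R B) :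
    Function.Bijective (inducedMap ⟨projKillingForm R B, hκ⟩) := by
  constructor
  · rw [injective_iff_map_eq_zero]
    intro u hu
    obtain ⟨t, rfl⟩ := Submodule.mkQ_surjective _ u
    obtain ⟨w, hw⟩ := h𝔤.baseChange_eq_smul θ (isInvariantBilin_universalForm (R := R) (L := B))
    have key : ∀ t : B ⊗[R] B, (1 : S) ⊗ₜ[R] (ibfRelations R B).mkQ t =
        algebraMap R S (TensorProduct.lift (projKillingForm R B) t) • w := by
      intro t
      induction t with
      | zero => simp
      | add t u ht hu => simp only [map_add, TensorProduct.tmul_add, ht, hu, add_smul]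
      | tmul x y =>
        have := hw (1 ⊗ₜ x) (1 ⊗ₜ y)
        rw [LinearMap.BilinMap.baseChange_tmul, LinearMap.BilinForm.baseChange_tmul, mul_one,
          ← Algebra.algebraMap_eq_smul_one] at this
        exact this
    rw [← Module.FaithfullyFlat.one_tmul_eq_zero_iff R (UniversalIBF R B) (A := S), key]
    have h0 : TensorProduct.lift (projKillingForm R B) t = 0 := hu
    rw [h0, map_zero, zero_smul]
  · rw [← LinearMap.range_eq_top]
    -- The extension of `I` to `S` contains all values of the form on `S ⊗ B`, among them `1`; by
    -- faithful flatness `I` is the contraction of its extension.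
    set I : Ideal R := LinearMap.range (inducedMap ⟨projKillingForm R B, hκ⟩) with hI
    have hmem : ∀ x y : S ⊗[R] B,
        (projKillingForm R B).baseChange S x y ∈ I.map (algebraMap R S) := by
      intro x y
      induction x with
      | zero => simp
      | add x x' h h' => rw [map_add, LinearMap.add_apply]; exact add_mem h h'
      | tmul s x =>
        induction y with
        | zero => simp
        | add y y' h h' => rw [map_add]; exact add_mem h h'
        | tmul t y =>
          rw [LinearMap.BilinForm.baseChange_tmul, Algebra.smul_def]
          exact Ideal.mul_mem_right _ _ (Ideal.mem_map_of_mem _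
            ⟨Submodule.mkQ _ (x ⊗ₜ y), TensorProduct.lift.tmul (f' := projKillingForm R B) x y⟩)
    obtain ⟨x, y, hxy⟩ := h𝔤.exists_killingForm_eq_one
    have htop : I.map (algebraMap R S) = ⊤ := by
      rw [Ideal.eq_top_iff_one]
      convert hmem (θ.symm (1 ⊗ₜ x)) (θ.symm (1 ⊗ₜ y))
      rw [projKillingForm_baseChange_of_equiv θ, LieEquiv.apply_symm_apply,
        LieEquiv.apply_symm_apply, killingForm, LieModule.traceForm_baseChange,
        LinearMap.BilinForm.baseChange_tmul]
      rw [killingForm] at hxy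
      simp [hxy]
    rw [← Ideal.comap_map_eq_self_of_faithfullyFlat (B := S) I, htop, Ideal.comap_top]

end TwistedForm

end

theorem mainTheorem5
    {k : Type*} [Field k] [CharZero k]
    {𝔤 : Type*} [LieRing 𝔤] [LieAlgebra k 𝔤] [Module.Finite k 𝔤] [LieAlgebra.IsSemisimple k 𝔤]
    {R : Type*} [CommRing R] [Algebra k R]
    {S : Type uS} [CommRing S] [Algebra k S] [Algebra R S] [IsScalarTower k R S]
    [Module.FaithfullyFlat R S]
    {B : Type*} [LieRing B] [LieAlgebra R B] [Module k B] [IsScalarTower k R B]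
    (hB : IsSplitBy k R S 𝔤 B) :
    -- first part: `𝔤` semisimple
    (Module.Finite R B ∧ Module.Projective R B ∧ IsPerfectLie R B ∧
      -- the Killing form of `B` is the unique form associated to the Killing form of `𝔤`
      IsAssociatedForm.{uT} (killingForm k 𝔤) (projKillingForm R B) ∧
      (∀ β : LinearMap.BilinForm R B,
        IsAssociatedForm.{uS} (killingForm k 𝔤) β → β = projKillingForm R B) ∧
      IsNonsingular (projKillingForm R B) ∧
      IsAutInvariant.{uT} (projKillingForm R B) ∧
      -- it is the restriction of the Killing form of `𝔤 ⊗ T` if `B` is realized in `𝔤 ⊗ T`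
      (∀ (T : Type uT) [CommRing T] [Algebra k T] [Algebra R T] [IsScalarTower k R T]
        [Module.FaithfullyFlat R T] (ι : B →ₗ[R] T ⊗[k] 𝔤), IsRealization ι →
        ∀ x y : B, algebraMap R T (projKillingForm R B x y) =
          killingForm T (T ⊗[k] 𝔤) (ι x) (ι y))) ∧
    -- second part: `𝔤` central
    (IsCentralLie k 𝔤 →
      LieAlgebra.IsSimple k 𝔤 ∧
      IsCentralLie R B ∧
      (∃ b : Module.Basis Unit R (invariantForms R B),
        (b () : LinearMap.BilinForm R B) = projKillingForm R B) ∧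
      SatisfiesIBFPrinciple.{uV} k (projKillingForm R B) ∧
      -- every invariant `k`-bilinear map is `φ ∘ κ_B` for a unique `φ`
      (∀ (V : Type uV) [AddCommGroup V] [Module k V] (γ : B →ₗ[k] B →ₗ[k] V),
        IsInvariantBilin γ →
        ∃! φ : R →ₗ[k] V, ∀ x y : B, γ x y = φ (projKillingForm R B x y))) := by
  -- Cartan's criterion: the one place where characteristic `0` enters.
  have : LieAlgebra.IsKilling k 𝔤 := inferInstance
  have hfin : Module.Finite R B := hB.finite S
  have hproj : Module.Projective R B := hB.projective S
  have hperf : IsPerfectLie R B := hB.isPerfectLie S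
  obtain ⟨θ⟩ := hB
  have hκ : projKillingForm R B ∈ invariantForms R B := isInvariantBilin_projKillingForm_of_equiv θ
  have hns : IsNonsingular (projKillingForm R B) := isNonsingular_projKillingForm_of_equiv θ
  refine ⟨⟨hfin, hproj, hperf, ?_, ?_, hns, isAutInvariant_projKillingForm, ?_⟩, fun h𝔤 => ?_⟩
  · intro T _ _ _ _ _ θ x y
    rw [projKillingForm_baseChange_of_equiv θ, killingForm, LieModule.traceForm_baseChange]
  · intro β hβ
    ext x y
    apply FaithfulSMul.algebraMap_injective R S
    -- The single splitting `θ` over `S` already determines `β`.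
    have := hβ S θ (1 ⊗ₜ x) (1 ⊗ₜ y)
    rw [LinearMap.BilinForm.baseChange_tmul, mul_one, ← Algebra.algebraMap_eq_smul_one] at this
    rw [this, algebraMap_projKillingForm θ, killingForm, killingForm,
      LieModule.traceForm_baseChange]
  · intro T _ _ _ _ _ ι hι x y
    obtain ⟨θ, hθ⟩ := hι.exists_lieEquiv
    rw [algebraMap_projKillingForm θ, hθ, hθ]
  · have hbij := h𝔤.bijective_inducedMap θ hκ
    obtain ⟨b, hb⟩ := exists_basis_invariantForms hperf hbij
    exact ⟨h𝔤.isSimple,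
      isCentralLie_of_bijective hperf hbij (projKillingForm_comm_of_equiv θ) hns,
      ⟨b, congrArg Subtype.val hb⟩, satisfiesIBFPrinciple_of_bijective hperf hκ hbij,
      fun V _ _ γ hγ => existsUnique_comp_form hperf hbij hγ⟩
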